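/- Let $R$ be a commutative ring with unit; write $\otimes=\otimes_R$ and $C^*=\mathrm{Hom}_R(C,R)$. A \emph{rational pairing} $T=(C,A,\langle -,-\rangle)$ consists of an $R$-coalgebra $(C,\Delta,\varepsilon)$, an associative unital $R$-algebra $A$ and an $R$-bilinear form $\langle -,-\rangle : C\times A\to R$ such that (a) for every $R$-module $M$ the map $\alpha_M : M\otimes C\to \mathrm{Hom}_R(A,M)$, $m\otimes c\mapsto [a\mapsto \langle c,a\rangle m]$, is injective; (b) the map $A\to C^*$, $a\mapsto\langle -,a\rangle$, is a homomorphism of $R$-algebras for the convolution product on $C^*$, i.e. $\langle c,ab\rangle=\sum\langle c_1,a\rangle\langle c_2,b\rangle$ and $\langle c,1\rangle=\varepsilon(c)$, where $\Delta(c)=\sum c_1\otimes c_2$. An element $m$ of a left $A$-module $M$ is \emph{rational} if there are finitely many $m_i\in M$, $c_i\in C$ with $am=\sum_i \langle c_i,a\rangle m_i$ for all $a\in A$; then $\{(m_i,c_i)\}$ is called a rational set of parameters for $m$. The rational elements form an $A$-submodule $\mathrm{Rat}^T(M)$ of $M$, and $M$ is \emph{rational} if $M=\mathrm{Rat}^T(M)$.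 Let $\mathrm{Rat}^T(A\text{-Mod})$ be the full subcategory of the category $A\text{-Mod}$ of left $A$-modules whose objects are the rational modules, and let $\mathcal{M}^C$ be the category of right $C$-comodules and colinear maps. Regard $C$ as a left $A$-module ${}_AC$ via $ac=\sum\langle c_2,a\rangle c_1$, and let $\sigma[{}_AC]$ be the full subcategory of $A\text{-Mod}$ of all modules isomorphic to a submodule of a factor module of a direct sum of copies of ${}_AC$. \textbf{Theorem.} Let $T=(C,A,\langle -,-\rangle)$ be a rational pairing. Then: 1. $\mathrm{Rat}^T : A\text{-Mod}\to A\text{-Mod}$ (acting on morphisms by restriction) is a left exact preradical, i.e. it is a subfunctor of the identity functor via the inclusions $\mathrm{Rat}^T(M)\subseteq M$, and it is a left exact functor. 2. The categories $\mathrm{Rat}^T(A\text{-Mod})$ and $\mathcal{M}^C$ are isomorphic. More precisely, the functor $\mathcal{M}^C\to \mathrm{Rat}^T(A\text{-Mod})$ that sends a comodule $(M,\rho)$ to the abelian group $M$ with the action $am=\sum\langle m_1,a\rangle m_0$, where $\rho(m)=\sum m_0\otimes m_1$ (so that $\rho(m)$ gives a rational set of parameters for $m$), and a colinear map to itself, is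 an isomorphism of categories: it has a strict two-sided inverse functor. 3. $\mathrm{Rat}^T(A\text{-Mod})=\sigma[{}_AC]$. -/

import Mathlib

open CategoryTheory TensorProduct

universe u

/-! ### Rational systems -/

section RationalSystem

variable {R P A : Type u} [CommRing R] [AddCommGroup P] [Module R P] [AddCommGroup A] [Module R A]

/-- The `R`-linear map `α_M : M ⊗ P → Hom_R(A, M)`, `m ⊗ p ↦ (a ↦ ⟨p, a⟩ m)`, attached to a
bilinear form `⟨-, -⟩ : P × A → R`. -/
noncomputable def pairingAlpha (bil : P →ₗ[R] A →ₗ[R] R)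
    (M : Type u) [AddCommGroup M] [Module R M] : M ⊗[R] P →ₗ[R] (A →ₗ[R] M) :=
  TensorProduct.lift
    (LinearMap.mk₂ R (fun (m : M) (p : P) => (bil p).smulRight m)
      (fun m m' p => by ext a; simp)
      (fun r m p => by ext a; exact smul_comm _ _ _)
      (fun m p p' => by ext a; simp [add_smul])
      (fun r m p => by ext a; simp [mul_smul]))

@[simp] theorem pairingAlpha_tmul (bil : P →ₗ[R] A →ₗ[R] R)
    (M : Type u) [AddCommGroup M] [Module R M] (m : M) (p : P) (a : A) :
    pairingAlpha bil M (m ⊗ₜ[R] p) a = bil p a • m := by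
  simp [pairingAlpha]

/-- `(P, A, ⟨-, -⟩)` is a rational system if `α_M` is injective for every `R`-module `M`. -/
def IsRationalSystem (bil : P →ₗ[R] A →ₗ[R] R) : Prop :=
  ∀ (M : Type u) [AddCommGroup M] [Module R M], Function.Injective (pairingAlpha bil M)

end RationalSystem

/-- A rational pairing `(C, A, ⟨-, -⟩)`: a rational system in which `C` is an `R`-coalgebra, `A` is
an `R`-algebra and `a ↦ ⟨-, a⟩` is a homomorphism of algebras from `A` to the convolution algebra
`C^*`, that is, `⟨c, ab⟩ = ∑ ⟨c₁, a⟩ ⟨c₂, b⟩` and `⟨c, 1⟩ = ε(c)`. -/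
structure RationalPairing (R C A : Type u) [CommRing R] [AddCommGroup C] [Module R C]
    [Coalgebra R C] [Ring A] [Algebra R A] where
  bil : C →ₗ[R] A →ₗ[R] R
  isRationalSystem : IsRationalSystem bil
  bil_mul : ∀ (c : C) (a b : A), bil c (a * b) =
    LinearMap.mul' R R (TensorProduct.map (bil.flip a) (bil.flip b) (Coalgebra.comul (R := R) c))
  bil_one : ∀ c : C, bil c 1 = Coalgebra.counit (R := R) c

/-! ### The category of right comodules -/

/-- A right `C`-comodule. -/
structure RightComod (R C : Type u) [CommRing R] [AddCommGroup C] [Module R C]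
    [Coalgebra R C] where
  carrier : Type u
  [addCommGroup : AddCommGroup carrier]
  [module : Module R carrier]
  coact : carrier →ₗ[R] carrier ⊗[R] C
  coassoc : (TensorProduct.assoc R carrier C C).toLinearMap ∘ₗ coact.rTensor C ∘ₗ coact =
    (Coalgebra.comul (R := R) (A := C)).lTensor carrier ∘ₗ coact
  coact_counit : (TensorProduct.rid R carrier).toLinearMap ∘ₗ
    (Coalgebra.counit (R := R) (A := C)).lTensor carrier ∘ₗ coact = LinearMap.id

namespace RightComod

variable {R C : Type u} [CommRing R] [AddCommGroup C] [Module R C] [Coalgebra R C]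

instance : CoeSort (RightComod R C) (Type u) := ⟨RightComod.carrier⟩

instance (M : RightComod R C) : AddCommGroup M := M.addCommGroup

instance (M : RightComod R C) : Module R M := M.module

/-- Colinear maps: `R`-linear maps `f` with `ρ_N ∘ f = (f ⊗ id) ∘ ρ_M`. -/
@[ext] structure Hom (M N : RightComod R C) where
  toLinearMap : M →ₗ[R] N
  colinear : N.coact ∘ₗ toLinearMap = toLinearMap.rTensor C ∘ₗ M.coact

instance : Category (RightComod R C) where
  Hom M N := Hom M N
  id M := ⟨LinearMap.id, by simp⟩
  comp f g := ⟨g.toLinearMap ∘ₗ f.toLinearMap, by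
    rw [← LinearMap.comp_assoc, g.colinear, LinearMap.comp_assoc, f.colinear,
      ← LinearMap.comp_assoc, ← LinearMap.rTensor_comp]⟩

/-- The coalgebra `C` as a right comodule over itself, with coaction `Δ`. -/
def regular (R C : Type u) [CommRing R] [AddCommGroup C] [Module R C] [Coalgebra R C] :
    RightComod R C where
  carrier := C
  coact := Coalgebra.comul
  coassoc := Coalgebra.coassoc
  coact_counit := by
    ext c
    simp

end RightComod

/-! ### Preradicals, isomorphisms of categories, subgenerated modules -/

/-- A natural transformation `i : r ⟶ 𝟭` exhibits `r` as a left exact preradical: it exhibits `r`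
as a subfunctor of the identity, and the functor `r` is left exact. -/
def IsLeftExactPreradical {𝒜 : Type*} [Category 𝒜] {r : 𝒜 ⥤ 𝒜} (i : r ⟶ 𝟭 𝒜) : Prop :=
  (∀ X : 𝒜, Mono (i.app X)) ∧ Limits.PreservesFiniteLimits r

/-- A functor is an isomorphism of categories if it has a strict two-sided inverse. -/
def IsIsoOfCategories {𝒜 ℬ : Type*} [Category 𝒜] [Category ℬ] (F : 𝒜 ⥤ ℬ) : Prop :=
  ∃ G : ℬ ⥤ 𝒜, F ⋙ G = 𝟭 𝒜 ∧ G ⋙ F = 𝟭 ℬ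

/-- `σ[N]`: the modules isomorphic to a submodule of a factor module of a direct sum of copies
of `N`. -/
def sigmaSubgenerated {A : Type u} [Ring A] (N : ModuleCat.{u} A) :
    ObjectProperty (ModuleCat.{u} A) := fun M =>
  ∃ (ι : Type u) (K : Submodule A (ι →₀ N)) (L : Submodule A ((ι →₀ N) ⧸ K)),
    Nonempty (M ≃ₗ[A] L)

/-! ### Rational modules -/

namespace RationalPairing

variable {R C A : Type u} [CommRing R] [AddCommGroup C] [Module R C] [Coalgebra R C]
  [Ring A] [Algebra R A] (T : RationalPairing R C A)

/-- An element `m` of a left `A`-module is rational if there are finitely many `xᵢ ∈ M`, `cᵢ ∈ C`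
with `a m = ∑ ⟨cᵢ, a⟩ xᵢ` for all `a ∈ A`. (Scalars of `R` act on `M` through `R → A`.) -/
def IsRational {M : Type u} [AddCommGroup M] [Module A M] (m : M) : Prop :=
  ∃ (n : ℕ) (x : Fin n → M) (c : Fin n → C),
    ∀ a : A, a • m = ∑ i, algebraMap R A (T.bil (c i) a) • x i

theorem bil_alpha_comul (c : C) (a b : A) :
    T.bil (pairingAlpha T.bil C (Coalgebra.comul (R := R) c) b) a = T.bil c (a * b) := by
  rw [T.bil_mul]
  generalize Coalgebra.comul (R := R) c = t
  induction t with
  | zero => simp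
  | tmul x y => simp [mul_comm]
  | add s t hs ht => simp [hs, ht]

/-- `Rat(M)`: the set of rational elements of `M`, which is an `A`-submodule of `M`. -/
def ratSubmodule (M : Type u) [AddCommGroup M] [Module A M] : Submodule A M where
  carrier := {m | T.IsRational m}
  zero_mem' := ⟨0, Fin.elim0, Fin.elim0, by simp⟩
  add_mem' := by
    rintro m m' ⟨n, x, c, h⟩ ⟨n', x', c', h'⟩
    refine ⟨n + n', Fin.append x x', Fin.append c c', fun a => ?_⟩
    simp [Fin.sum_univ_add, smul_add, h, h']
  smul_mem' := by
    rintro b m ⟨n, x, c, h⟩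
    refine ⟨n, x, fun i => pairingAlpha T.bil C (Coalgebra.comul (R := R) (c i)) b, fun a => ?_⟩
    simp only [bil_alpha_comul]
    rw [← mul_smul, h]

theorem IsRational.map {T : RationalPairing R C A} {M N : Type u} [AddCommGroup M] [Module A M]
    [AddCommGroup N] [Module A N] (f : M →ₗ[A] N) {m : M} (hm : T.IsRational m) :
    T.IsRational (f m) := by
  obtain ⟨n, x, c, h⟩ := hm
  exact ⟨n, f ∘ x, c, fun a => by rw [← map_smul, h, map_sum]; simp⟩

/-- The functor `Rat : A-Mod ⥤ A-Mod`; on morphisms it is restriction. -/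
def rat : ModuleCat.{u} A ⥤ ModuleCat.{u} A where
  obj M := ModuleCat.of A (T.ratSubmodule M)
  map f := ModuleCat.ofHom
    (f.hom.restrict (p := T.ratSubmodule _) (q := T.ratSubmodule _) fun _ hm => hm.map f.hom)

/-- The inclusions `Rat(M) ⊆ M`. -/
def ratInclusion : T.rat ⟶ 𝟭 (ModuleCat.{u} A) where
  app M := ModuleCat.ofHom (T.ratSubmodule M).subtype

/-- A left `A`-module `M` is rational if `M = Rat(M)`. -/
def isRationalModule : ObjectProperty (ModuleCat.{u} A) := fun M => T.ratSubmodule M = ⊤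

/-- `Rat(A-Mod)`: the full subcategory of rational left `A`-modules. -/
abbrev RatMod : Type (u + 1) := T.isRationalModule.FullSubcategory

/-! ### The rational module of a comodule -/

section

variable {M : Type u} [AddCommGroup M] [Module R M]

theorem alpha_one (t : M ⊗[R] C) : pairingAlpha T.bil M t 1 =
    TensorProduct.rid R M ((Coalgebra.counit (R := R) (A := C)).lTensor M t) := by
  induction t with
  | zero => simp
  | tmul x y => simp [T.bil_one]
  | add s t hs ht => simp [hs, ht]

theorem alpha_mul (t : M ⊗[R] C) (a b : A) : pairingAlpha T.bil M t (a * b) =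
    pairingAlpha T.bil M (pairingAlpha T.bil (M ⊗[R] C) ((TensorProduct.assoc R M C C).symm
      ((Coalgebra.comul (R := R) (A := C)).lTensor M t)) b) a := by
  induction t with
  | zero => simp
  | add s t hs ht => simp [hs, ht]
  | tmul m c =>
    simp only [pairingAlpha_tmul, LinearMap.lTensor_tmul, T.bil_mul]
    generalize Coalgebra.comul (R := R) c = w
    induction w with
    | zero => simp
    | tmul x y =>
      simp only [TensorProduct.map_tmul, LinearMap.mul'_apply, LinearMap.flip_apply,
        TensorProduct.assoc_symm_tmul, pairingAlpha_tmul, map_smul, LinearMap.smul_apply]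
      rw [mul_comm, mul_smul]
    | add s t hs ht => simp [hs, ht, add_smul, TensorProduct.tmul_add]

theorem alpha_map {N : Type u} [AddCommGroup N] [Module R N] (f : M →ₗ[R] N) (t : M ⊗[R] C)
    (a : A) : pairingAlpha T.bil N (f.rTensor C t) a = f (pairingAlpha T.bil M t a) := by
  induction t with
  | zero => simp
  | tmul x y => simp
  | add s t hs ht => simp [hs, ht]

end

/-- The left `A`-action `a m = ∑ ⟨m₁, a⟩ m₀` on a right `C`-comodule, where
`ρ(m) = ∑ m₀ ⊗ m₁`. -/
@[reducible] noncomputable def comodAction (M : RightComod R C) : Module A M where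
  smul a m := pairingAlpha T.bil M (M.coact m) a
  one_smul m := by
    change pairingAlpha T.bil M (M.coact m) 1 = m
    rw [alpha_one]
    exact LinearMap.congr_fun M.coact_counit m
  mul_smul a b m := by
    change pairingAlpha T.bil M (M.coact m) (a * b) =
      pairingAlpha T.bil M (M.coact (pairingAlpha T.bil M (M.coact m) b)) a
    have h : (Coalgebra.comul (R := R) (A := C)).lTensor M (M.coact m) =
        TensorProduct.assoc R M C C (M.coact.rTensor C (M.coact m)) :=
      (LinearMap.congr_fun M.coassoc m).symm
    rw [alpha_mul, h, LinearEquiv.symm_apply_apply, alpha_map]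
  smul_zero a := by
    change pairingAlpha T.bil M (M.coact 0) a = 0
    simp
  smul_add a m n := by
    change pairingAlpha T.bil M (M.coact (m + n)) a =
      pairingAlpha T.bil M (M.coact m) a + pairingAlpha T.bil M (M.coact n) a
    simp
  add_smul a b m := (pairingAlpha T.bil M (M.coact m)).map_add a b
  zero_smul m := (pairingAlpha T.bil M (M.coact m)).map_zero

/-- The left `A`-module underlying a right `C`-comodule. -/
noncomputable def moduleOfComod (M : RightComod R C) : ModuleCat.{u} A :=
  letI := T.comodAction M
  ModuleCat.of A M

theorem algebraMap_smul_comod (M : RightComod R C) (r : R) (m : M) :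
    letI := T.comodAction M
    algebraMap R A r • m = r • m := by
  change pairingAlpha T.bil M (M.coact m) (algebraMap R A r) = r • m
  rw [Algebra.algebraMap_eq_smul_one, map_smul, alpha_one]
  congr 1
  exact LinearMap.congr_fun M.coact_counit m

theorem moduleOfComod_rational (M : RightComod R C) : T.isRationalModule (T.moduleOfComod M) := by
  let _ := T.comodAction M
  change T.ratSubmodule M = ⊤
  refine eq_top_iff.2 fun m _ => ?_
  obtain ⟨n, x, c, h⟩ : ∃ (n : ℕ) (x : Fin n → M) (c : Fin n → C),
      M.coact m = ∑ i, x i ⊗ₜ[R] c i := by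
    generalize M.coact m = t
    induction t with
    | zero => exact ⟨0, Fin.elim0, Fin.elim0, by simp⟩
    | tmul x c => exact ⟨1, fun _ => x, fun _ => c, by simp⟩
    | add s t hs ht =>
      obtain ⟨n, x, c, h⟩ := hs
      obtain ⟨n', x', c', h'⟩ := ht
      exact ⟨n + n', Fin.append x x', Fin.append c c', by simp [Fin.sum_univ_add, h, h']⟩
  refine ⟨n, x, c, fun a => ?_⟩
  simp only [algebraMap_smul_comod]
  change pairingAlpha T.bil M (M.coact m) a = _
  simp [h]

/-- The functor from right `C`-comodules to rational left `A`-modules: a comodule is sent to the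
same additive group with the action `a m = ∑ ⟨m₁, a⟩ m₀`, so that `∑ m₀ ⊗ m₁ = ρ(m)` is a rational
set of parameters for `m`; a colinear map is sent to itself. -/
noncomputable def comodToRat : RightComod R C ⥤ T.RatMod where
  obj M := ⟨T.moduleOfComod M, T.moduleOfComod_rational M⟩
  map {M N} f := ObjectProperty.homMk <|
    letI := T.comodAction M
    letI := T.comodAction N
    ModuleCat.ofHom
      { toFun := f.toLinearMap
        map_add' := map_add _
        map_smul' := fun a m => by
          change f.toLinearMap (pairingAlpha T.bil M (M.coact m) a) =
            pairingAlpha T.bil N (N.coact (f.toLinearMap m)) a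
          rw [← alpha_map]
          congr 2
          exact (LinearMap.congr_fun f.colinear m).symm }

/-- The left `A`-module `C`, with action `a c = ∑ ⟨c₂, a⟩ c₁`. -/
noncomputable def moduleC : ModuleCat.{u} A := T.moduleOfComod (RightComod.regular R C)

end RationalPairing

/-! Everything follows from injectivity of `α_M`. An element `m` is rational iff its orbit map `a ↦
a m` is some `α_M(t)`, and then `t` is unique; setting `ρ(m) = t` turns a rational module into a
comodule, the comodule axioms being the module axioms read through `α`. Likewise `A`-linear maps
between comodules are colinear. Left exactness of `Rat` amounts to `Rat(L) = L ∩ Rat(M)` for `L ⊆ M`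
(`isRational_of_injective`), which uses injectivity of `α_{M/L}`. Hence rational modules are closed
under submodules, and evidently under quotients and direct sums, so `σ[C]` consists of rational
modules. Conversely, `ρ` embeds a comodule `M` into `M ⊗ C`, a quotient of a direct sum of copies of
`C`. -/

namespace CategoryTheory.Functor

/-- The inverse takes preimages under the fully faithful `F`, conjugated by `eqToHom` because `F.obj
(g X)` and `X` are only propositionally equal. -/
theorem isIsoOfCategories_of_bijective_obj {𝒜 ℬ : Type*} [Category 𝒜] [Category ℬ] (F : 𝒜 ⥤ ℬ)
    [F.Full] [F.Faithful] (h : Function.Bijective F.obj) : IsIsoOfCategories F := by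
  obtain ⟨g, hgF, hFg⟩ := Function.bijective_iff_has_inverse.1 h
  let G : ℬ ⥤ 𝒜 :=
    { obj := g
      map := fun {X Y} f => F.preimage (eqToHom (hFg X) ≫ f ≫ eqToHom (hFg Y).symm)
      map_id := fun X => F.map_injective (by simp)
      map_comp := fun f f' => F.map_injective (by simp) }
  refine ⟨G, ?_, ?_⟩
  · refine Functor.ext hgF fun X Y f => F.map_injective ?_
    simp [G, eqToHom_map]
  · refine Functor.ext hFg fun X Y f => ?_
    simp [G]

end CategoryTheory.Functor

theorem sigmaSubgenerated_of_surjective_of_injective {A : Type u} [Ring A] {N M : ModuleCat.{u} A}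
    {ι Q : Type u} [AddCommGroup Q] [Module A Q] (g : (ι →₀ N) →ₗ[A] Q)
    (hg : Function.Surjective g) (f : M →ₗ[A] Q) (hf : Function.Injective f) :
    sigmaSubgenerated N M := by
  let e := g.quotKerEquivOfSurjective hg
  let f' : M →ₗ[A] (ι →₀ N) ⧸ LinearMap.ker g := e.symm.toLinearMap ∘ₗ f
  have hf' : Function.Injective f' := e.symm.injective.comp hf
  exact ⟨ι, LinearMap.ker g, LinearMap.range f', ⟨LinearEquiv.ofInjective f' hf'⟩⟩

theorem TensorProduct.exists_fin_sum_tmul {R M N : Type*} [CommRing R] [AddCommGroup M]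
    [Module R M] [AddCommGroup N] [Module R N] (t : M ⊗[R] N) :
    ∃ (n : ℕ) (x : Fin n → M) (y : Fin n → N), t = ∑ i, x i ⊗ₜ[R] y i := by
  induction t with
  | zero => exact ⟨0, Fin.elim0, Fin.elim0, by simp⟩
  | tmul x y => exact ⟨1, fun _ => x, fun _ => y, by simp⟩
  | add s t hs ht =>
    obtain ⟨n, x, y, h⟩ := hs
    obtain ⟨n', x', y', h'⟩ := ht
    exact ⟨n + n', Fin.append x x', Fin.append y y', by simp [Fin.sum_univ_add, h, h']⟩

namespace RationalPairing

variable {R C A : Type u} [CommRing R] [AddCommGroup C] [Module R C] [Coalgebra R C]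
  [Ring A] [Algebra R A] (T : RationalPairing R C A)

section Scalars

variable {M : Type u} [AddCommGroup M] [Module R M] [Module A M] [IsScalarTower R A M]

theorem isRational_iff_exists_tensor (m : M) :
    T.IsRational m ↔ ∃ t : M ⊗[R] C, ∀ a : A, pairingAlpha T.bil M t a = a • m := by
  constructor
  · rintro ⟨n, x, c, h⟩
    refine ⟨∑ i, x i ⊗ₜ[R] c i, fun a => ?_⟩
    simp [h]
  · rintro ⟨t, h⟩
    obtain ⟨n, x, c, rfl⟩ := TensorProduct.exists_fin_sum_tmul t
    refine ⟨n, x, c, fun a => ?_⟩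
    rw [← h]
    simp

end Scalars

/-! ### Closure properties of rational modules. -/

section Closure

variable {M N : Type u} [AddCommGroup M] [Module A M] [AddCommGroup N] [Module A N]

/-- Rational elements are detected by injective maps, so `Rat(L) = L ∩ Rat(M)` for `L ⊆ M`. -/
theorem isRational_of_injective (f : M →ₗ[A] N) (hf : Function.Injective f) {m : M}
    (hm : T.IsRational (f m)) : T.IsRational m := by
  let := Module.compHom M (algebraMap R A)
  let := Module.compHom N (algebraMap R A)
  have : IsScalarTower R A M := .of_algebraMap_smul fun _ _ => rfl
  have : IsScalarTower R A N := .of_algebraMap_smul fun _ _ => rfl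
  let f' : M →ₗ[R] N := f.restrictScalars R
  let q : N →ₗ[R] N ⧸ LinearMap.range f' := (LinearMap.range f').mkQ
  have hex : Function.Exact f' q := LinearMap.exact_map_mkQ_range f'
  obtain ⟨t, ht⟩ := (T.isRational_iff_exists_tensor (f m)).1 hm
  -- Modulo `f(M)` every `a • f m` vanishes, so `α` kills the image of `t`.
  have hqt : q.rTensor C t = 0 := by
    apply T.isRationalSystem (N ⧸ LinearMap.range f')
    ext a
    rw [alpha_map, ht, ← map_smul, map_zero, LinearMap.zero_apply]
    exact hex.apply_apply_eq_zero (a • m)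
  -- Right exactness of `- ⊗ C` lifts `t` to `M ⊗ C`.
  obtain ⟨s, rfl⟩ := (rTensor_exact C hex (Submodule.mkQ_surjective _) t).1 hqt
  refine (T.isRational_iff_exists_tensor m).2 ⟨s, fun a => hf ?_⟩
  rw [map_smul, ← ht, alpha_map]
  rfl

theorem isRational_of_ratSubmodule_eq_top (h : T.ratSubmodule M = ⊤) (m : M) :
    T.IsRational m :=
  h.ge (Submodule.mem_top (x := m))

theorem ratSubmodule_finsupp_eq_top (ι : Type u) (h : T.ratSubmodule M = ⊤) :
    T.ratSubmodule (ι →₀ M) = ⊤ := by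
  refine eq_top_iff.2 fun v _ => ?_
  induction v using Finsupp.induction_linear with
  | zero => exact zero_mem _
  | add v w hv hw => exact add_mem (hv trivial) (hw trivial)
  | single i m => exact (T.isRational_of_ratSubmodule_eq_top h m).map (Finsupp.lsingle i)

theorem isRationalModule_of_sigmaSubgenerated {X Y : ModuleCat.{u} A} (hX : T.isRationalModule X)
    (hY : sigmaSubgenerated X Y) : T.isRationalModule Y := by
  obtain ⟨ι, K, L, ⟨e⟩⟩ := hY
  refine eq_top_iff.2 fun y _ =>
    T.isRational_of_injective (L.subtype ∘ₗ e.toLinearMap)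
      (L.subtype_injective.comp e.injective) ?_
  obtain ⟨v, hv⟩ := K.mkQ_surjective ((L.subtype ∘ₗ e.toLinearMap) y)
  rw [← hv]
  exact (T.isRational_of_ratSubmodule_eq_top (T.ratSubmodule_finsupp_eq_top ι hX) v).map K.mkQ

end Closure

/-! ### Left exactness of `Rat`. -/

section Preradical

instance : T.rat.Additive where

theorem isLeftExactPreradical_ratInclusion : IsLeftExactPreradical T.ratInclusion := by
  refine ⟨fun M => (ModuleCat.mono_iff_injective _).2 (T.ratSubmodule M).subtype_injective, ?_⟩
  refine ((T.rat.preservesFiniteLimits_tfae).out 0 3).1 fun S hS => ?_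
  have hinj : Function.Injective S.f.hom := hS.moduleCat_injective_f
  have hex := (ShortComplex.ShortExact.moduleCat_exact_iff_function_exact S).1 hS.exact
  refine ⟨?_, (ModuleCat.mono_iff_injective _).2 fun x y hxy =>
    Subtype.ext (hinj (congrArg Subtype.val hxy))⟩
  rw [ShortComplex.ShortExact.moduleCat_exact_iff_function_exact]
  rintro ⟨y, hy⟩
  constructor
  · intro h
    obtain ⟨x, rfl⟩ := (hex y).1 (congrArg Subtype.val h)
    exact ⟨⟨x, T.isRational_of_injective S.f.hom hinj hy⟩, rfl⟩
  · rintro ⟨x, hx⟩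
    exact Subtype.ext ((hex y).2 ⟨x.1, congrArg Subtype.val hx⟩)

end Preradical

/-! ### Comodules as rational modules, and the subgenerator `C`. -/

section Comodules

theorem alpha_coact (M : RightComod R C) (m : M) (a : A) :
    letI := T.comodAction M
    pairingAlpha T.bil M (M.coact m) a = a • m := rfl

instance : T.comodToRat.Faithful where
  map_injective {M N f g} h := by
    apply RightComod.Hom.ext
    ext m
    let := T.comodAction M
    let := T.comodAction N
    exact congr($(h).hom.hom m)

instance : T.comodToRat.Full where
  map_surjective {M N} φ := by
    let := T.comodAction M
    let := T.comodAction N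
    let f : M →ₗ[A] N := φ.hom.hom
    let f' : M →ₗ[R] N :=
      { toFun := f
        map_add' := map_add f
        map_smul' := fun r m => by
          rw [← T.algebraMap_smul_comod M, map_smul, T.algebraMap_smul_comod N]
          rfl }
    refine ⟨⟨f', ?_⟩, rfl⟩
    ext m
    apply T.isRationalSystem N
    ext a
    change pairingAlpha T.bil N (N.coact (f m)) a = pairingAlpha T.bil N (f'.rTensor C _) a
    rw [alpha_map]
    exact (map_smul f a m).symm

/-- The `A`-module remembers the `R`-action through `R → A`, and the coaction through injectivity of
`α`. -/
theorem moduleOfComod_injective : Function.Injective T.moduleOfComod := by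
  rintro M M' h
  have hM := T.algebraMap_smul_comod M
  have hM' := T.algebraMap_smul_comod M'
  have hα := T.alpha_coact M
  have hα' := T.alpha_coact M'
  unfold moduleOfComod at h
  generalize T.comodAction M = mm at *
  -- Once the actions are opaque, the module equality can be substituted componentwise; `hM` and
  -- `hα` keep what is needed about them.
  generalize T.comodAction M' = mm' at *
  obtain @⟨X, iX, jX, ρ, h1, h2⟩ := M
  obtain @⟨X', iX', jX', ρ', h1', h2'⟩ := M'
  obtain rfl : X = X' := congrArg ModuleCat.carrier h
  obtain rfl : iX = iX' := eq_of_heq (congr_arg_heq (fun N : ModuleCat A => N.isAddCommGroup) h)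
  obtain rfl : mm = mm' := eq_of_heq (congr_arg_heq (fun N : ModuleCat A => N.isModule) h)
  obtain rfl : jX = jX' := Module.ext' _ _ fun r m => (hM r m).symm.trans (hM' r m)
  obtain rfl : ρ = ρ' := by
    ext m
    apply T.isRationalSystem X
    ext a
    exact (hα m a).trans (hα' m a).symm
  rfl

theorem exists_comod_of_isRationalModule (N : ModuleCat.{u} A) (hN : T.isRationalModule N) :
    ∃ M : RightComod R C, T.moduleOfComod M = N := by
  let := Module.compHom N (algebraMap R A)
  have : IsScalarTower R A N := .of_algebraMap_smul fun _ _ => rfl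
  have hα : Function.Injective (pairingAlpha T.bil N) := T.isRationalSystem N
  let act : N →ₗ[R] A →ₗ[R] N := (Algebra.lsmul R R N).toLinearMap.flip
  have hact : ∀ m, act m ∈ LinearMap.range (pairingAlpha T.bil N) := fun m => by
    obtain ⟨t, ht⟩ :=
      (T.isRational_iff_exists_tensor m).1 (T.isRational_of_ratSubmodule_eq_top hN m)
    exact ⟨t, LinearMap.ext ht⟩
  let ρ : N →ₗ[R] N ⊗[R] C :=
    (LinearEquiv.ofInjective _ hα).symm.toLinearMap ∘ₗ act.codRestrict _ hact
  have hρ : ∀ m a, pairingAlpha T.bil N (ρ m) a = a • m := fun m a =>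
    congr($(congrArg Subtype.val
      ((LinearEquiv.ofInjective _ hα).apply_symm_apply (act.codRestrict _ hact m))) a)
  let M : RightComod R C :=
    { carrier := N
      coact := ρ
      coassoc := by
        ext m
        apply (TensorProduct.assoc R N C C).symm.injective
        -- Two uses of injectivity, for `N ⊗ C` and then for `N`, reduce coassociativity to `(a * b)
        -- • m = a • b • m`.
        apply T.isRationalSystem (N ⊗[R] C)
        ext b
        apply hα
        ext a
        simp only [LinearMap.comp_apply, LinearEquiv.coe_coe, LinearEquiv.symm_apply_apply]
        rw [← alpha_mul, alpha_map, hρ, hρ, hρ, mul_smul]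
      coact_counit := by
        ext m
        change TensorProduct.rid R N ((Coalgebra.counit (R := R) (A := C)).lTensor N (ρ m)) = m
        rw [← T.alpha_one, hρ, one_smul] }
  have hM : T.comodAction M = N.isModule := Module.ext' _ _ fun a m => hρ m a
  refine ⟨M, ?_⟩
  change @ModuleCat.of A _ N _ (T.comodAction M) = N
  rw [hM]

theorem isIsoOfCategories_comodToRat : IsIsoOfCategories T.comodToRat := by
  refine T.comodToRat.isIsoOfCategories_of_bijective_obj ⟨fun M M' h => ?_, fun N => ?_⟩
  · exact T.moduleOfComod_injective (congrArg ObjectProperty.FullSubcategory.obj h)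
  · obtain ⟨M, hM⟩ := T.exists_comod_of_isRationalModule N.obj N.property
    exact ⟨M, ObjectProperty.FullSubcategory.ext hM⟩

theorem sigmaSubgenerated_moduleOfComod (M : RightComod R C) :
    sigmaSubgenerated T.moduleC (T.moduleOfComod M) := by
  let : Module A C := T.comodAction (RightComod.regular R C)
  let : Module A M := T.comodAction M
  have hC : ∀ (r : R) (c : C), algebraMap R A r • c = r • c :=
    T.algebraMap_smul_comod (RightComod.regular R C)
  have : IsScalarTower R A C := .of_algebraMap_smul hC
  -- `C` stands on the left of the tensor product because `A` acts through that factor. Under `α`,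
  -- this action becomes right translation of the argument by `a`.
  have hmul : ∀ (t : C ⊗[R] M) (a b : A),
      pairingAlpha T.bil M (TensorProduct.comm R C M (a • t)) b =
        pairingAlpha T.bil M (TensorProduct.comm R C M t) (b * a) := fun t a b => by
    induction t with
    | zero => simp
    | add s t hs ht => simp only [smul_add, map_add, LinearMap.add_apply, hs, ht]
    | tmul c m =>
      rw [TensorProduct.smul_tmul', TensorProduct.comm_tmul, TensorProduct.comm_tmul,
        pairingAlpha_tmul, pairingAlpha_tmul, ← bil_alpha_comul]
      rfl
  let g : (M →₀ C) →ₗ[A] C ⊗[R] M :=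
    Finsupp.lsum ℕ fun m => ((TensorProduct.AlgebraTensorModule.mk R A C M).flip m)
  have hg : Function.Surjective g := fun t => by
    induction t with
    | zero => exact ⟨0, map_zero g⟩
    | tmul c m => exact ⟨Finsupp.single m c, by simp [g]⟩
    | add s t hs ht =>
      obtain ⟨v, rfl⟩ := hs
      obtain ⟨w, rfl⟩ := ht
      exact ⟨v + w, map_add g v w⟩
  -- The flipped coaction is `A`-linear: under `α_M` both sides at `b` give `(b * a) • m`.
  -- Evaluating at `1` recovers `m`, whence injectivity.
  let f : M →ₗ[A] C ⊗[R] M :=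
    { toFun := fun m => (TensorProduct.comm R C M).symm (M.coact m)
      map_add' := fun m m' => by simp
      map_smul' := fun a m => by
        apply (TensorProduct.comm R C M).injective
        apply T.isRationalSystem M
        ext b
        rw [RingHom.id_apply, hmul, LinearEquiv.apply_symm_apply, LinearEquiv.apply_symm_apply,
          alpha_coact, alpha_coact, mul_smul] }
  have hf : Function.Injective f := fun m m' h => by
    have h' : M.coact m = M.coact m' := (TensorProduct.comm R C M).symm.injective h
    rw [← one_smul A m, ← one_smul A m', ← alpha_coact, ← alpha_coact, h']
  exact sigmaSubgenerated_of_surjective_of_injective g hg f hf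

theorem isRationalModule_eq_sigmaSubgenerated :
    T.isRationalModule = sigmaSubgenerated T.moduleC := by
  ext N
  refine ⟨fun hN => ?_,
    T.isRationalModule_of_sigmaSubgenerated (T.moduleOfComod_rational (RightComod.regular R C))⟩
  obtain ⟨M, rfl⟩ := T.exists_comod_of_isRationalModule N hN
  exact T.sigmaSubgenerated_moduleOfComod M

end Comodules

end RationalPairing

theorem mainTheorem6 {R C A : Type u} [CommRing R] [AddCommGroup C] [Module R C] [Coalgebra R C]
    [Ring A] [Algebra R A] (T : RationalPairing R C A) :
    IsLeftExactPreradical T.ratInclusion ∧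
    IsIsoOfCategories T.comodToRat ∧
    T.isRationalModule = sigmaSubgenerated T.moduleC :=
  ⟨T.isLeftExactPreradical_ratInclusion, T.isIsoOfCategories_comodToRat,
    T.isRationalModule_eq_sigmaSubgenerated⟩
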